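/- Let $X$ be a complex manifold, with structure sheaf $\mathcal O_X$, holomorphic tangent sheaf $\mathcal T_X$ and sheaf of holomorphic $1$-forms $\Omega_X=\mathcal T_X^\vee$. Let $c_1(X)=c_1(\mathcal T_X)=c_1(\det \mathcal T_X)\in H^1(X,\Omega_X)$ be the first Chern class of $X$, i.e. the class of the \v{C}ech cocycle $(d\log g_{ij})$, where $(g_{ij})$ are the holomorphic transition functions of the line bundle $\det\mathcal T_X$ with respect to an atlas (equivalently, the trace of the Atiyah class of $\mathcal T_X$; another normalization by a non-zero constant such as $\pm 1/(2\pi i)$ does not affect the statement). Then for every $q\ge 0$ the contraction $$c_1(X)\,\lrcorner\,\cdot\;\colon\; H^q(X,\mathcal T_X)\longrightarrow H^{q+1}(X,\mathcal O_X),$$ that is, the cup product with $c_1(X)$ followed by the map induced by the natural pairing $\Omega_X\otimes\mathcal T_X\to\mathcal O_X$, is the zero map. -/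

import Mathlib

open scoped Manifold ContDiff Bundle

set_option linter.unusedSectionVars false
set_option linter.unusedVariables false

noncomputable section

namespace ComplexManifold

open CategoryTheory Limits MonoidalCategory TopologicalSpace Opposite Abelian Bundle

/-! ## Sheaves of complex vector spaces, their tensor product and their cohomology -/

/-- Sheaves of `ℂ`-vector spaces on a topological space. -/
abbrev VSheaf (X : Type) [TopologicalSpace X] : Type 1 :=
  Sheaf (Opens.grothendieckTopology X) (ModuleCat.{0} ℂ)

/-- Sheafification. -/
abbrev sheafify (X : Type) [TopologicalSpace X] : ((Opens X)ᵒᵖ ⥤ ModuleCat.{0} ℂ) ⥤ VSheaf X :=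
  presheafToSheaf (Opens.grothendieckTopology X) (ModuleCat.{0} ℂ)

/-- The underlying presheaf of a sheaf. -/
abbrev toPresheaf (X : Type) [TopologicalSpace X] : VSheaf X ⥤ ((Opens X)ᵒᵖ ⥤ ModuleCat.{0} ℂ) :=
  sheafToPresheaf (Opens.grothendieckTopology X) (ModuleCat.{0} ℂ)

/-- The sheafification adjunction. -/
abbrev sheafifyAdj (X : Type) [TopologicalSpace X] : sheafify X ⊣ toPresheaf X :=
  sheafificationAdjunction (Opens.grothendieckTopology X) (ModuleCat.{0} ℂ)

section Tensor

variable (X : Type) [TopologicalSpace X]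

/-- The tensor product over `ℂ` of sheaves of `ℂ`-vector spaces; see `tensorSheafIso`. -/
instance : MonoidalCategory (VSheaf X) := Sheaf.monoidalCategory _ _

instance : SymmetricCategory (VSheaf X) := Sheaf.symmetricCategory _ _

open MonoidalClosed.FunctorCategory in
instance : MonoidalClosed (VSheaf X) :=
  Monoidal.Reflective.monoidalClosed (sheafificationAdjunction _ _)

instance : (sheafify X).Monoidal := inferInstance

/-- A sheaf is its own sheafification. -/
def sheafifySelfIso {X : Type} [TopologicalSpace X] (F : VSheaf X) : (sheafify X).obj F.obj ≅ F :=
  (asIso (sheafifyAdj X).counit).app F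

/-- `F ⊗ G` is the sheafification of `U ↦ F(U) ⊗ G(U)`. -/
def tensorSheafIso {X : Type} [TopologicalSpace X] (F G : VSheaf X) :
    F ⊗ G ≅ (sheafify X).obj (F.obj ⊗ G.obj) :=
  ((sheafifySelfIso F).symm ⊗ᵢ (sheafifySelfIso G).symm) ≪≫
    Functor.Monoidal.μIso (sheafify X) F.obj G.obj

lemma tensorIso_naturality {X : Type} [TopologicalSpace X] {F F' : VSheaf X} (f : F ⟶ F') (G : VSheaf X) :
    (f ▷ G) ≫ (tensorSheafIso F' G).hom = (tensorSheafIso F G).hom ≫ (sheafify X).map (f.hom ▷ G.obj) := by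
  have h1 : f ≫ (sheafifySelfIso F').inv = (sheafifySelfIso F).inv ≫ (sheafify X).map f.hom := by
    rw [Iso.comp_inv_eq, Category.assoc, Iso.eq_inv_comp]
    exact ((sheafifyAdj X).counit.naturality f).symm
  simp only [tensorSheafIso, Iso.trans_hom, Functor.Monoidal.μIso_hom, MonoidalCategory.tensorIso_hom,
    Iso.symm_hom]
  rw [Category.assoc, ← Functor.LaxMonoidal.μ_natural_left, ← Category.assoc, ← Category.assoc,
    ← tensorHom_id, ← tensorHom_id, tensorHom_comp_tensorHom, tensorHom_comp_tensorHom, h1,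
    Category.id_comp, Category.comp_id]

/-- The functor `- ⊗ G` as a composition of exact functors. -/
def tensorRightIso {X : Type} [TopologicalSpace X] (G : VSheaf X) :
    tensorRight G ≅ toPresheaf X ⋙ tensorRight G.obj ⋙ sheafify X :=
  NatIso.ofComponents (fun F ↦ tensorSheafIso F G) (fun f ↦ tensorIso_naturality f G)

instance presheaf_tensorRight_lex {X : Type} [TopologicalSpace X] (G : (Opens X)ᵒᵖ ⥤ ModuleCat.{0} ℂ) :
    PreservesFiniteLimits (tensorRight G) := by
  refine preservesFiniteLimits_of_evaluation _ fun U ↦ ?_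
  exact inferInstanceAs (PreservesFiniteLimits ((evaluation _ _).obj U ⋙ tensorRight (G.obj U)))

instance (G : VSheaf X) : PreservesFiniteLimits (tensorRight G) :=
  preservesFiniteLimits_of_natIso (tensorRightIso G).symm

instance (G : VSheaf X) : PreservesFiniteColimits (tensorRight G) :=
  ⟨fun _ _ _ ↦ preservesColimitsOfShape_of_natIso (BraidedCategory.tensorLeftIsoTensorRight G)⟩

instance (G : VSheaf X) : (tensorRight G).Additive :=
  Functor.additive_of_preserves_binary_products _

end Tensor

section Cohomology

variable {X : Type} [TopologicalSpace X]

/-- The constant sheaf `ℂ_X`, which is the unit of the tensor product. -/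
abbrev constSheaf (X : Type) [TopologicalSpace X] : VSheaf X :=
  (constantSheaf (Opens.grothendieckTopology X) (ModuleCat.{0} ℂ)).obj (ModuleCat.of ℂ ℂ)

lemma tensorUnit_eq (X : Type) [TopologicalSpace X] : 𝟙_ (VSheaf X) = constSheaf X := rfl

/-- Sheaf cohomology `H^n(X, F)`: the derived functors `Ext^n(ℂ_X, F)` of global sections
in the abelian category of sheaves of `ℂ`-vector spaces. -/
abbrev H (n : ℕ) (F : VSheaf X) : Type := Ext (constSheaf X) F n

/-- The cup product `H^p(X, F) × H^q(X, G) → H^(q+p)(X, F ⊗ G)`: viewing `b` as a morphism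
`ℂ_X → G[q]` and `a` as a morphism `ℂ_X → F[p]` in the derived category, it is the composition of
`b` with `a ⊗ G : G = ℂ_X ⊗ G → F ⊗ G[p]`. The functor `- ⊗ G` is exact because we work over a
field. -/
def cup {F G : VSheaf X} {p q : ℕ} (a : H p F) (b : H q G) : H (q + p) (F ⊗ G) :=
  b.comp ((Ext.mk₀ (λ_ G).inv).comp
    (Ext.mapExactFunctor (tensorRight G) (show Ext (𝟙_ (VSheaf X)) F p from a)) (zero_add p)) rfl

/-- The morphism `F ⊗ G ⟶ K` of sheaves given by bilinear maps `F(U) ⊗ G(U) → K(U)` that are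
compatible with restriction. -/
def pairingHom {F G K : VSheaf X} (m : F.obj ⊗ G.obj ⟶ K.obj) : F ⊗ G ⟶ K :=
  (tensorSheafIso F G).hom ≫ ((sheafifyAdj X).homEquiv _ _).symm m

end Cohomology

/-! ## The class in `H^1(X, F)` of a Čech 1-cocycle

For an open cover `V` of `X`, there is a short exact sequence of sheaves
`0 → F → 𝒞⁰(V, F) → 𝒵¹(V, F) → 0`, where `𝒞⁰(V, F)(U) = ∏ F(U ∩ V i)` and `𝒵¹(V, F)(U)` is the space
of 1-cocycles `a i j ∈ F(U ∩ V i ∩ V j)`. The class of a cocycle on `X` is its image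
under the connecting map `H^0(X, 𝒵¹(V, F)) → H^1(X, F)`. -/

section Cech

variable {X : Type} [TopologicalSpace X]

/-- Restriction of sections. -/
def VSheaf.res (F : VSheaf X) {U V : Opens X} (h : V ≤ U) :
    F.obj.obj (op U) →ₗ[ℂ] F.obj.obj (op V) :=
  (F.obj.map (homOfLE h).op).hom

lemma VSheaf.map_eq_res (F : VSheaf X) {U V : (Opens X)ᵒᵖ} (f : U ⟶ V) (s : F.obj.obj U) :
    F.obj.map f s = F.res (U := U.unop) (V := V.unop) f.unop.le s := rfl

lemma VSheaf.res_res (F : VSheaf X) {U V W : Opens X} (h : V ≤ U) (h' : W ≤ V)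
    (s : F.obj.obj (op U)) : F.res h' (F.res h s) = F.res (h'.trans h) s := by
  simp only [VSheaf.res]
  rw [← LinearMap.comp_apply, ← ModuleCat.hom_comp, ← F.obj.map_comp]
  rfl

lemma VSheaf.res_self (F : VSheaf X) {U : Opens X} (s : F.obj.obj (op U)) :
    F.res le_rfl s = s :=
  ConcreteCategory.congr_hom (F.obj.map_id (op U)) s

lemma VSheaf.hom_res {F G : VSheaf X} (f : F ⟶ G) {U V : Opens X} (h : V ≤ U)
    (s : F.obj.obj (op U)) : f.hom.app (op V) (F.res h s) = G.res h (f.hom.app (op U) s) :=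
  ConcreteCategory.congr_hom (f.hom.naturality (homOfLE h).op) s

lemma VSheaf.ext_of_cover (F : VSheaf X) {ι : Type*} {U : Opens X} (W : ι → Opens X)
    (hW : ∀ i, W i ≤ U) (hU : U ≤ iSup W) (s t : F.obj.obj (op U))
    (h : ∀ i, F.res (hW i) s = F.res (hW i) t) : s = t :=
  TopCat.Sheaf.eq_of_locally_eq' (X := TopCat.of X) F W U (fun i ↦ homOfLE (hW i)) hU s t h

lemma VSheaf.glue (F : VSheaf X) {ι : Type*} {U : Opens X} (W : ι → Opens X)
    (hW : ∀ i, W i ≤ U) (hU : U ≤ iSup W) (s : ∀ i, F.obj.obj (op (W i)))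
    (h : ∀ i j, F.res (inf_le_left : W i ⊓ W j ≤ W i) (s i) =
      F.res (inf_le_right : W i ⊓ W j ≤ W j) (s j)) :
    ∃ t : F.obj.obj (op U), ∀ i, F.res (hW i) t = s i :=
  (TopCat.Sheaf.existsUnique_gluing' (X := TopCat.of X) F W U (fun i ↦ homOfLE (hW i)) hU s h).exists

/-- The presheaf `U ↦ ∏ k, F(U ∩ V k)`. -/
def cechPresheaf (F : VSheaf X) {κ : Type} (V : κ → Opens X) : (Opens X)ᵒᵖ ⥤ ModuleCat.{0} ℂ where
  obj U := ModuleCat.of ℂ (∀ k, F.obj.obj (op (U.unop ⊓ V k)))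
  map {U U'} f := ModuleCat.ofHom (LinearMap.pi fun k ↦
    (F.res (inf_le_inf_right (V k) f.unop.le)).comp (LinearMap.proj k))
  map_id U := by
    ext s k; exact F.res_self _
  map_comp f g := by
    ext s k; exact (F.res_res _ _ (s k)).symm

lemma cechPresheaf_isSheaf (F : VSheaf X) {κ : Type} (V : κ → Opens X) :
    Presheaf.IsSheaf (Opens.grothendieckTopology X) (cechPresheaf F V) := by
  refine (TopCat.Presheaf.isSheaf_iff_isSheafUniqueGluing (X := TopCat.of X) (cechPresheaf F V)).mpr ?_
  intro ι U sf hsf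
  have hle (k : κ) (i : ι) : U i ⊓ V k ≤ iSup U ⊓ V k := inf_le_inf_right _ (le_iSup U i)
  have hcov (k : κ) : iSup U ⊓ V k ≤ ⨆ i, U i ⊓ V k := by rw [iSup_inf_eq]
  have key (k : κ) : ∃ t : F.obj.obj (op (iSup U ⊓ V k)), ∀ i, F.res (hle k i) t = sf i k := by
    refine F.glue (fun i ↦ U i ⊓ V k) (hle k) (hcov k) (fun i ↦ sf i k) fun i j ↦ ?_
    have h := congrFun (hsf i j) k
    have e : (U i ⊓ V k) ⊓ (U j ⊓ V k) ≤ (U i ⊓ U j) ⊓ V k :=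
      le_inf (inf_le_inf inf_le_left inf_le_left) (inf_le_left.trans inf_le_right)
    have h' := congrArg (F.res e) h
    erw [F.res_res, F.res_res] at h'
    exact h'
  choose t ht using key
  refine ⟨t, fun i ↦ funext fun k ↦ ht k i, fun t' ht' ↦ funext fun k ↦ ?_⟩
  refine F.ext_of_cover (fun i ↦ U i ⊓ V k) (hle k) (hcov k) _ _ fun i ↦ ?_
  exact (congrFun (ht' i) k).trans (ht k i).symm

/-- The sheaf `U ↦ ∏ k, F(U ∩ V k)`. -/
def cechSheaf (F : VSheaf X) {κ : Type} (V : κ → Opens X) : VSheaf X :=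
  ⟨cechPresheaf F V, cechPresheaf_isSheaf F V⟩

section
variable (F : VSheaf X) {ι : Type} (V : ι → Opens X)

/-- The 1-cocycles over `U`: families `a (i, j) ∈ F(U ∩ V i ∩ V j)` with
`a (i, j) + a (j, k) = a (i, k)` on `U ∩ V i ∩ V j ∩ V k`. -/
def oneCocycles (U : Opens X) :
    Submodule ℂ (∀ p : ι × ι, F.obj.obj (op (U ⊓ (V p.1 ⊓ V p.2)))) where
  carrier := {a | ∀ i j k,
    F.res (V := U ⊓ (V i ⊓ V j ⊓ V k)) (inf_le_inf_left U inf_le_left) (a (i, j)) +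
      F.res (V := U ⊓ (V i ⊓ V j ⊓ V k))
        (inf_le_inf_left U (inf_le_inf_right (V k) inf_le_right)) (a (j, k)) =
      F.res (V := U ⊓ (V i ⊓ V j ⊓ V k))
        (inf_le_inf_left U (inf_le_inf_right (V k) inf_le_left)) (a (i, k))}
  zero_mem' i j k := by simp
  add_mem' {a b} ha hb i j k := by
    simp only [Pi.add_apply, map_add]
    rw [← ha i j k, ← hb i j k]; abel
  smul_mem' c a ha i j k := by
    simp only [Pi.smul_apply, map_smul]
    rw [← ha i j k, smul_add]

/-- The presheaf of 1-cocycles. -/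
def cocyclePresheaf : (Opens X)ᵒᵖ ⥤ ModuleCat.{0} ℂ where
  obj U := ModuleCat.of ℂ (oneCocycles F V U.unop)
  map {U U'} f := ModuleCat.ofHom (LinearMap.restrict
    ((cechPresheaf F fun p : ι × ι ↦ V p.1 ⊓ V p.2).map f).hom (by
      intro a ha i j k
      have h := congrArg (F.res (inf_le_inf_right (V i ⊓ V j ⊓ V k) f.unop.le)) (ha i j k)
      rw [map_add, F.res_res, F.res_res, F.res_res] at h
      change F.res _ (F.res _ _) + F.res _ (F.res _ _) = F.res _ (F.res _ _)
      rw [F.res_res, F.res_res, F.res_res]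
      exact h))
  map_id U := by
    refine ConcreteCategory.hom_ext _ _ fun s ↦ Subtype.ext (funext fun k ↦ F.res_self _)
  map_comp f g := by
    refine ConcreteCategory.hom_ext _ _ fun s ↦ Subtype.ext (funext fun k ↦ ?_)
    exact (F.res_res _ _ (s.1 k)).symm

lemma cocyclePresheaf_isSheaf :
    Presheaf.IsSheaf (Opens.grothendieckTopology X) (cocyclePresheaf F V) := by
  refine (TopCat.Presheaf.isSheaf_iff_isSheafUniqueGluing (X := TopCat.of X) (cocyclePresheaf F V)).mpr ?_
  intro κ U sf hsf
  obtain ⟨t, ht, ht'⟩ := (TopCat.Presheaf.isSheaf_iff_isSheafUniqueGluing (X := TopCat.of X) _).mp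
    (cechPresheaf_isSheaf F fun p : ι × ι ↦ V p.1 ⊓ V p.2) U (fun m ↦ (sf m).1)
    (fun m n ↦ congrArg Subtype.val (hsf m n))
  have htm : t ∈ oneCocycles F V (iSup U) := by
    intro i j k
    refine F.ext_of_cover (fun m ↦ U m ⊓ (V i ⊓ V j ⊓ V k))
      (fun m ↦ inf_le_inf_right _ (le_iSup U m)) (by rw [iSup_inf_eq]) _ _ fun m ↦ ?_
    have e (p : ι × ι) : F.res (inf_le_inf_right _ (le_iSup U m)) (t p) = (sf m).1 p :=
      congrFun (ht m) p
    have h := (sf m).2 i j k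
    rw [← e, ← e, ← e, F.res_res, F.res_res, F.res_res] at h
    rw [map_add, F.res_res, F.res_res, F.res_res]
    exact h
  refine ⟨⟨t, htm⟩, fun m ↦ Subtype.ext (ht m), fun s hs ↦ Subtype.ext (ht' s.1 fun m ↦ ?_)⟩
  exact congrArg Subtype.val (hs m)

/-- The sheaf `𝒵¹(V, F)` of 1-cocycles. -/
def cocycleSheaf : VSheaf X := ⟨cocyclePresheaf F V, cocyclePresheaf_isSheaf F V⟩

/-- The map `F → 𝒞⁰(V, F)`, `s ↦ (s|_{V i})`. -/
def cechAug : F ⟶ cechSheaf F V where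
  hom :=
    { app U := ModuleCat.ofHom (LinearMap.pi fun i ↦ F.res inf_le_left)
      naturality {U U'} f := by
        ext s; funext i
        exact (F.res_res _ _ s).trans (F.res_res _ _ s).symm }

/-- The map `𝒞⁰(V, F) → 𝒵¹(V, F)`, `(s i) ↦ (s j - s i)`. -/
def cechD : cechSheaf F V ⟶ cocycleSheaf F V where
  hom :=
    { app U := ModuleCat.ofHom (LinearMap.codRestrict (oneCocycles F V U.unop)
        (LinearMap.pi fun p ↦
          (F.res (inf_le_inf_left U.unop inf_le_right)).comp (LinearMap.proj p.2) -
          (F.res (inf_le_inf_left U.unop inf_le_left)).comp (LinearMap.proj p.1)) (by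
        intro s i j k
        simp only [LinearMap.pi_apply, LinearMap.sub_apply, LinearMap.comp_apply,
          LinearMap.proj_apply, map_sub, F.res_res]
        abel))
      naturality {U U'} f := by
        ext s
        refine Subtype.ext (funext fun p ↦ ?_)
        change F.res _ (F.res _ (s p.2)) - F.res _ (F.res _ (s p.1)) =
          F.res _ (F.res _ (s p.2) - F.res _ (s p.1))
        rw [map_sub, F.res_res, F.res_res, F.res_res, F.res_res] }

lemma cechD_apply (U : Opens X) (s : ∀ i, F.obj.obj (op (U ⊓ V i))) (i j : ι) :
    ((cechD F V).hom.app (op U) s).1 (i, j) =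
      F.res (inf_le_inf_left U inf_le_right) (s j) - F.res (inf_le_inf_left U inf_le_left) (s i) :=
  rfl

/-- The sequence `0 → F → 𝒞⁰(V, F) → 𝒵¹(V, F) → 0`. -/
def cechSES : ShortComplex (VSheaf X) where
  f := cechAug F V
  g := cechD F V
  zero := by
    apply ObjectProperty.hom_ext
    ext U s
    refine Subtype.ext (funext fun p ↦ ?_)
    change F.res _ (F.res _ s) - F.res _ (F.res _ s) = 0
    rw [F.res_res, F.res_res, sub_self]

lemma cover_inf (hV : ⨆ i, V i = ⊤) (U : Opens X) : U ≤ ⨆ i, U ⊓ V i := by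
  rw [← inf_iSup_eq, hV, inf_top_eq]

lemma cechAug_injective (hV : ⨆ i, V i = ⊤) (U : Opens X) :
    Function.Injective ((cechAug F V).hom.app (op U)) := by
  intro s t h
  exact F.ext_of_cover (fun i ↦ U ⊓ V i) (fun i ↦ inf_le_left) (cover_inf V hV U) s t
    fun i ↦ congrFun h i

lemma cech_exact (hV : ⨆ i, V i = ⊤) (U : Opens X) (s : ∀ i, F.obj.obj (op (U ⊓ V i)))
    (h : (cechD F V).hom.app (op U) s = 0) : ∃ t, (cechAug F V).hom.app (op U) t = s := by
  obtain ⟨t, ht⟩ := F.glue (fun i ↦ U ⊓ V i) (fun i ↦ inf_le_left) (cover_inf V hV U) s (by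
    intro i j
    have h' := sub_eq_zero.mp (congrFun (congrArg Subtype.val h) (i, j))
    have e : (U ⊓ V i) ⊓ (U ⊓ V j) ≤ U ⊓ (V i ⊓ V j) :=
      le_inf (inf_le_left.trans inf_le_left) (inf_le_inf inf_le_right inf_le_right)
    have h'' := congrArg (F.res e) h'
    erw [F.res_res, F.res_res] at h''
    exact h''.symm)
  exact ⟨t, funext ht⟩

lemma cechD_locallySurjective (hV : ⨆ i, V i = ⊤) :
    Sheaf.IsLocallySurjective (cechD F V) := by
  refine (TopCat.Presheaf.isLocallySurjective_iff (X := TopCat.of X) (cechD F V).hom).mpr fun U t x hx ↦ ?_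
  obtain ⟨m, hm⟩ := Opens.mem_iSup.mp (show x ∈ ⨆ i, V i by rw [hV]; trivial)
  have e (i : ι) : (U ⊓ V m) ⊓ V i ≤ U ⊓ (V m ⊓ V i) := by rw [inf_assoc]
  refine ⟨U ⊓ V m, inf_le_left, ⟨fun i ↦ F.res (e i) (t.1 (m, i)), ?_⟩, hx, hm⟩
  refine Subtype.ext (funext fun ⟨i, j⟩ ↦ ?_)
  change F.res _ (F.res _ (t.1 (m, j))) - F.res _ (F.res _ (t.1 (m, i))) = F.res _ (t.1 (i, j))
  have e' : U ⊓ V m ⊓ (V i ⊓ V j) ≤ U ⊓ (V m ⊓ V i ⊓ V j) := by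
    rw [inf_assoc, inf_assoc]
  have h := congrArg (F.res e') (t.2 m i j)
  rw [map_add, F.res_res, F.res_res, F.res_res] at h
  rw [F.res_res, F.res_res, ← h, add_sub_cancel_left]

lemma cechSES_shortExact (hV : ⨆ i, V i = ⊤) : (cechSES F V).ShortExact := by
  have hmono : Mono (cechAug F V) := by
    have (U : (Opens X)ᵒᵖ) : Mono ((cechAug F V).hom.app U) :=
      ConcreteCategory.mono_of_injective _ (cechAug_injective F V hV U.unop)
    have : Mono (cechAug F V).hom := NatTrans.mono_of_mono_app _
    exact (sheafToPresheaf _ _).mono_of_mono_map this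
  have hepi : Epi (cechD F V) := by
    have := cechD_locallySurjective F V hV
    exact Sheaf.epi_of_isLocallySurjective _
  have key : ∀ {W : VSheaf X} (k : W ⟶ cechSheaf F V), k ≫ cechD F V = 0 →
      ∃ l : W ⟶ F, l ≫ cechAug F V = k := by
    intro W k hk
    have h1 (U : (Opens X)ᵒᵖ) (w : W.obj.obj U) :
        ∃ t, (cechAug F V).hom.app U t = k.hom.app U w := by
      refine cech_exact F V hV U.unop (k.hom.app U w) ?_
      exact ConcreteCategory.congr_hom (congrArg (fun q ↦ q.hom.app U) hk) w
    choose l hl using h1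
    have inj (U : (Opens X)ᵒᵖ) : Function.Injective ((cechAug F V).hom.app U) :=
      cechAug_injective F V hV U.unop
    refine ⟨⟨{ app U := ModuleCat.ofHom
                { toFun := l U
                  map_add' a b := inj U (by rw [map_add, hl, hl, hl, map_add])
                  map_smul' c a := inj U (by
                    rw [RingHom.id_apply, map_smul, hl, hl, map_smul]) }
               naturality {U U'} f := ?_ }⟩, ?_⟩
    · refine ConcreteCategory.hom_ext _ _ fun w ↦ inj U' ?_
      change (cechAug F V).hom.app U' (l U' (W.obj.map f w)) =
        (cechAug F V).hom.app U' (F.obj.map f (l U w))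
      rw [hl, NatTrans.naturality_apply, NatTrans.naturality_apply, hl]
    · apply ObjectProperty.hom_ext
      ext U w
      exact hl U w
  have : Mono (cechSES F V).f := hmono
  exact
    { exact := ShortComplex.exact_of_f_is_kernel _ (KernelFork.IsLimit.ofι' _ _
        fun k hk ↦ ⟨(key k hk).choose, (key k hk).choose_spec⟩)
      mono_f := hmono
      epi_g := hepi }

end

/-- The morphism `ℂ_X ⟶ G` corresponding to a global section of `G`. -/
def globalSectionHom (G : VSheaf X) (t : G.obj.obj (op ⊤)) : constSheaf X ⟶ G :=
  ((sheafifyAdj X).homEquiv _ _).symm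
    { app U := ModuleCat.ofHom (LinearMap.toSpanSingleton ℂ _ (G.res (V := U.unop) le_top t))
      naturality {U U'} f := by
        refine ConcreteCategory.hom_ext _ _ fun (z : ℂ) ↦ ?_
        change z • G.res _ t = G.res f.unop.le (z • G.res _ t)
        rw [map_smul, G.res_res] }

/-- The class in `H^1(X, F)` of a 1-cocycle with respect to an open cover. -/
def cechClass (F : VSheaf X) {ι : Type} (V : ι → Opens X) (hV : ⨆ i, V i = ⊤)
    (a : oneCocycles F V ⊤) : H 1 F :=
  (Ext.mk₀ (globalSectionHom (cocycleSheaf F V) a)).comp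
    (cechSES_shortExact F V hV).extClass (zero_add 1)

end Cech

/-! ## Holomorphic sections, the sheaves `𝒪`, `𝒯`, `Ω` and the first Chern class -/

section Holomorphic

variable {E : Type} [NormedAddCommGroup E] [NormedSpace ℂ E]
  {M : Type} [TopologicalSpace M] [ChartedSpace E M]

section
variable (E) (F : Type) [NormedAddCommGroup F] [NormedSpace ℂ F]
  (V : M → Type) [TopologicalSpace (TotalSpace F V)] [∀ x, TopologicalSpace (V x)]
  [FiberBundle F V]

/-- Holomorphic sections over `U` of a vector bundle `V` with model fibre `F`. (For maps between
manifolds over `ℂ`, holomorphic means analytic, which is the regularity `ω`.) -/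
def IsHolSection (U : Opens M) (s : ∀ x : U, V x) : Prop :=
  ContMDiff 𝓘(ℂ, E) (𝓘(ℂ, E).prod 𝓘(ℂ, F)) ω
    (fun x : U ↦ (TotalSpace.mk (x : M) (s x) : TotalSpace F V))

variable {F V} in
lemma isHolSection_iff {U : Opens M} {s : ∀ x : U, V x} (t : ∀ x : M, V x)
    (h : ∀ x : U, s x = t x) :
    IsHolSection E F V U s ↔ ∀ x ∈ U, ContMDiffAt 𝓘(ℂ, E) (𝓘(ℂ, E).prod 𝓘(ℂ, F)) ω
      (fun x : M ↦ (TotalSpace.mk x (t x) : TotalSpace F V)) x := by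
  have e : s = fun x : U ↦ t x := funext h
  subst e
  refine ⟨fun H x hx ↦ ?_, fun H x ↦ ?_⟩
  · exact (contMDiffAt_subtype_iff (x := (⟨x, hx⟩ : U))
      (f := fun x : M ↦ (TotalSpace.mk x (t x) : TotalSpace F V))).mp (H ⟨x, hx⟩)
  · exact (contMDiffAt_subtype_iff (x := x)
      (f := fun x : M ↦ (TotalSpace.mk x (t x) : TotalSpace F V))).mpr (H x x.2)

variable [∀ x, AddCommGroup (V x)] [∀ x, Module ℂ (V x)]

open Classical in
variable {V} in
/-- Extension by zero of a function defined on an open set. -/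
def zeroExt {U : Opens M} (s : ∀ x : U, V x) (x : M) : V x :=
  if h : x ∈ U then s ⟨x, h⟩ else 0

variable {V} in
lemma zeroExt_apply {U : Opens M} (s : ∀ x : U, V x) (x : U) : s x = zeroExt s x := by
  simp [zeroExt]

lemma IsHolSection.res {U W : Opens M} (h : W ≤ U) {s : ∀ x : U, V x}
    (hs : IsHolSection E F V U s) : IsHolSection E F V W (fun x ↦ s ⟨x, h x.2⟩) :=
  (isHolSection_iff E (zeroExt s) fun x ↦ zeroExt_apply s ⟨x, h x.2⟩).mpr
    fun x hx ↦ (isHolSection_iff E _ (zeroExt_apply s)).mp hs x (h hx)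

variable [VectorBundle ℂ F V]

/-- The space of holomorphic sections of `V` over `U`. -/
def holSubmodule (U : Opens M) : Submodule ℂ (∀ x : U, V x) where
  carrier := {s | IsHolSection E F V U s}
  zero_mem' := (isHolSection_iff E (fun _ ↦ 0) (fun _ ↦ rfl)).mpr fun x _ ↦
    (contMDiff_zeroSection ℂ V).contMDiffAt
  add_mem' {s t} hs ht :=
    (isHolSection_iff E (zeroExt s + zeroExt t) (fun x ↦
      congrArg₂ (· + ·) (zeroExt_apply s x) (zeroExt_apply t x))).mpr fun x hx ↦
      ((isHolSection_iff E _ (zeroExt_apply s)).mp hs x hx).add_section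
        ((isHolSection_iff E _ (zeroExt_apply t)).mp ht x hx)
  smul_mem' c s hs :=
    (isHolSection_iff E (c • zeroExt s) (fun x ↦
      congrArg (c • ·) (zeroExt_apply s x))).mpr fun x hx ↦
      ((isHolSection_iff E _ (zeroExt_apply s)).mp hs x hx).const_smul_section

/-- The presheaf of holomorphic sections of `V`. -/
def holPresheaf : (Opens M)ᵒᵖ ⥤ ModuleCat.{0} ℂ where
  obj U := ModuleCat.of ℂ (holSubmodule E F V U.unop)
  map {U W} f := ModuleCat.ofHom
    { toFun s := ⟨fun x ↦ s.1 ⟨x.1, f.unop.le x.2⟩, IsHolSection.res E F V f.unop.le s.2⟩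
      map_add' _ _ := rfl
      map_smul' _ _ := rfl }

/-- Holomorphy as a local predicate. -/
def holLocalPredicate : TopCat.LocalPredicate (X := TopCat.of M) V where
  pred {U} s := IsHolSection E F V U s
  res i _ hs := IsHolSection.res E F V i.le hs
  locality {U} s h := (isHolSection_iff E _ (zeroExt_apply s)).mpr fun x hx ↦ by
    obtain ⟨W, hxW, i, hW⟩ := h ⟨x, hx⟩
    exact (isHolSection_iff E (zeroExt s) fun y ↦ zeroExt_apply s ⟨y, i.le y.2⟩).mp hW x hxW

lemma holPresheaf_isSheaf :
    Presheaf.IsSheaf (Opens.grothendieckTopology M) (holPresheaf E F V) :=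
  (TopCat.Presheaf.isSheaf_iff_isSheaf_comp (X := TopCat.of M) (forget _) (holPresheaf E F V)).mpr
    (TopCat.Presheaf.isSheaf_of_iso
      (NatIso.ofComponents (fun _ ↦ Iso.refl _) :
        TopCat.subpresheafToTypes (holLocalPredicate E F V).toPrelocalPredicate ≅
          holPresheaf E F V ⋙ forget (ModuleCat.{0} ℂ))
      (TopCat.subpresheafToTypes.isSheaf (holLocalPredicate E F V)))

/-- The sheaf of holomorphic sections of `V`. -/
def holSheaf : VSheaf M := ⟨holPresheaf E F V, holPresheaf_isSheaf E F V⟩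

end

variable (E M)
/-- The sheaf `𝒪_X` of holomorphic functions, i.e. sections of the trivial line bundle;
see `isHolSection_trivial_iff`. -/
def structureSheaf : VSheaf M := holSheaf E ℂ (Bundle.Trivial M ℂ)

variable [IsManifold 𝓘(ℂ, E) ω M]

/-- The sheaf `𝒯_X` of holomorphic vector fields. -/
def tangentSheaf : VSheaf M := holSheaf E E (TangentSpace 𝓘(ℂ, E) : M → Type)

/-- The (holomorphic) cotangent space: the dual of the tangent space. -/
abbrev CotangentSpace (x : M) : Type := TangentSpace 𝓘(ℂ, E) x →L[ℂ] Bundle.Trivial M ℂ x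

/-- The sheaf `Ω_X` of holomorphic 1-forms. -/
def cotangentSheaf : VSheaf M := holSheaf E (E →L[ℂ] ℂ) (CotangentSpace E M)

/-- The contraction `Ω_X(U) × 𝒯_X(U) → 𝒪_X(U)` of a 1-form with a vector field. -/
def contractSections (U : Opens M) :
    holSubmodule E (E →L[ℂ] ℂ) (CotangentSpace E M) U →ₗ[ℂ]
      holSubmodule E E (TangentSpace 𝓘(ℂ, E) : M → Type) U →ₗ[ℂ]
        holSubmodule E ℂ (Bundle.Trivial M ℂ) U :=
  LinearMap.mk₂ ℂ (fun α v ↦ ⟨fun x ↦ α.1 x (v.1 x), ContMDiff.clm_bundle_apply α.2 v.2⟩)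
    (fun _ _ _ ↦ rfl) (fun _ _ _ ↦ rfl)
    (fun α v w ↦ Subtype.ext (funext fun x ↦ map_add (α.1 x) _ _))
    (fun c α v ↦ Subtype.ext (funext fun x ↦ map_smul (α.1 x) c _))

/-- The contraction on the level of presheaves. -/
def contractPresheaf :
    (cotangentSheaf E M).obj ⊗ (tangentSheaf E M).obj ⟶ (structureSheaf E M).obj where
  app U := ModuleCat.ofHom (TensorProduct.lift (contractSections E M U.unop))
  naturality U W f := by
    refine ModuleCat.MonoidalCategory.tensor_ext fun α v ↦ rfl

/-- The contraction `Ω_X ⊗ 𝒯_X ⟶ 𝒪_X`. -/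
def contractHom : cotangentSheaf E M ⊗ tangentSheaf E M ⟶ structureSheaf E M :=
  pairingHom (contractPresheaf E M)

variable {E M} in
/-- The contraction `a ⌟ v ∈ H^(q+p)(X, 𝒪_X)` of `a ∈ H^p(X, Ω_X)` with `v ∈ H^q(X, 𝒯_X)`. -/
def contract {p q : ℕ} (a : H p (cotangentSheaf E M)) (v : H q (tangentSheaf E M)) :
    H (q + p) (structureSheaf E M) :=
  (cup a v).comp (Ext.mk₀ (contractHom E M)) (add_zero (q + p))

section dlog
variable {E M}
lemma isHolSection_trivial_iff {U : Opens M} {s : U → ℂ} :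
    IsHolSection E ℂ (Bundle.Trivial M ℂ) U s ↔ ContMDiff 𝓘(ℂ, E) 𝓘(ℂ, ℂ) ω s := by
  refine ⟨fun h x ↦ ?_, fun h x ↦ ?_⟩
  · have := (contMDiffAt_totalSpace.mp (h x)).2
    exact this
  · exact contMDiffAt_totalSpace.mpr ⟨contMDiff_subtype_val x, h x⟩

/-- The transition functions `g i j = det (ψ i ∘ (ψ j)⁻¹)` of the line bundle `det 𝒯_X`, where `ψ i`
is the trivialization of the tangent bundle given by the chart `i`. In other words, `g i j` is the
Jacobian determinant of the coordinates `i` with respect to the coordinates `j`. -/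
def detTransition (i j : atlas E M) (x : M) : ℂ :=
  ((tangentBundleCore 𝓘(ℂ, E) M).coordChange j i x).det

lemma detTransition_mul (i j k : atlas E M) {x : M} (hi : x ∈ i.1.source) (hj : x ∈ j.1.source)
    (hk : x ∈ k.1.source) :
    detTransition i k x = detTransition i j x * detTransition j k x := by
  have h : (tangentBundleCore 𝓘(ℂ, E) M).coordChange k i x =
      ((tangentBundleCore 𝓘(ℂ, E) M).coordChange j i x).comp
        ((tangentBundleCore 𝓘(ℂ, E) M).coordChange k j x) := by
    ext v
    exact ((tangentBundleCore 𝓘(ℂ, E) M).coordChange_comp k j i x ⟨⟨hk, hj⟩, hi⟩ v).symm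
  rw [detTransition, h]
  exact LinearMap.det_comp _ _

lemma detTransition_self (i : atlas E M) {x : M} (hi : x ∈ i.1.source) :
    detTransition i i x = 1 := by
  have h : (tangentBundleCore 𝓘(ℂ, E) M).coordChange i i x = ContinuousLinearMap.id ℂ E := by
    ext v
    exact (tangentBundleCore 𝓘(ℂ, E) M).coordChange_self i x hi v
  rw [detTransition, h]
  exact LinearMap.det_id

lemma detTransition_ne_zero (i j : atlas E M) {x : M} (hi : x ∈ i.1.source)
    (hj : x ∈ j.1.source) : detTransition i j x ≠ 0 := by
  intro h
  have := detTransition_mul i j i hi hj hi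
  rw [detTransition_self i hi, h, zero_mul] at this
  exact one_ne_zero this

variable [FiniteDimensional ℂ E]

lemma contDiff_det : ContDiff ℂ ω (fun f : E →L[ℂ] E ↦ f.det) := by
  let b := Module.finBasis ℂ E
  have h : (fun f : E →L[ℂ] E ↦ f.det) = fun f : E →L[ℂ] E ↦
      ∑ σ : Equiv.Perm (Fin (Module.finrank ℂ E)),
        (Equiv.Perm.sign σ : ℤ) • ∏ i, LinearMap.toMatrix b b (f : E →ₗ[ℂ] E) (σ i) i := by
    funext f
    rw [ContinuousLinearMap.det, ← LinearMap.det_toMatrix b, Matrix.det_apply]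
    rfl
  rw [h]
  refine ContDiff.sum fun σ _ ↦ ContDiff.const_smul _ (contDiff_prod fun i _ ↦ ?_)
  let L : (E →L[ℂ] E) →ₗ[ℂ] ℂ :=
    { toFun f := b.coord (σ i) (f (b i))
      map_add' f g := by simp
      map_smul' c f := by simp }
  have : (fun f : E →L[ℂ] E ↦ LinearMap.toMatrix b b (f : E →ₗ[ℂ] E) (σ i) i) =
      fun f ↦ LinearMap.toContinuousLinearMap L f := by
    funext f
    simp [L, LinearMap.toMatrix_apply]
  rw [this]
  exact ContinuousLinearMap.contDiff _

lemma contMDiffAt_detTransition (i j : atlas E M) {x : M} (hi : x ∈ i.1.source)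
    (hj : x ∈ j.1.source) : ContMDiffAt 𝓘(ℂ, E) 𝓘(ℂ, ℂ) ω (detTransition i j) x := by
  have : IsManifold 𝓘(ℂ, E) (ω + 1) M := by simpa
  have : (tangentBundleCore 𝓘(ℂ, E) M).IsContMDiff 𝓘(ℂ, E) ω := tangentBundleCore.isContMDiff
  have h := ((tangentBundleCore 𝓘(ℂ, E) M).contMDiffOn_coordChange 𝓘(ℂ, E) (n := ω) j i).contMDiffAt
    ((j.1.open_source.inter i.1.open_source).mem_nhds ⟨hj, hi⟩)
  exact (contDiff_det (E := E)).contMDiff.contMDiffAt.comp x h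

/-- The logarithmic derivative `dlog g = g⁻¹ dg`. -/
def dlog (g : M → ℂ) (x : M) : CotangentSpace E M x :=
  (g x)⁻¹ • (mfderiv 𝓘(ℂ, E) 𝓘(ℂ, ℂ) g x : TangentSpace 𝓘(ℂ, E) x →L[ℂ] ℂ)

lemma dlog_mul {g h : M → ℂ} {x : M} (hg : MDifferentiableAt 𝓘(ℂ, E) 𝓘(ℂ, ℂ) g x)
    (hh : MDifferentiableAt 𝓘(ℂ, E) 𝓘(ℂ, ℂ) h x) (hgx : g x ≠ 0) (hhx : h x ≠ 0) :
    dlog (E := E) (g * h) x = dlog g x + dlog h x := by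
  have e := (hg.hasMFDerivAt.mul hh.hasMFDerivAt).mfderiv
  unfold dlog
  rw [e]
  apply ContinuousLinearMap.ext
  intro v
  have key (a b : ℂ) : (g x * h x)⁻¹ * (g x * b + h x * a) = (g x)⁻¹ * a + (h x)⁻¹ * b := by
    field_simp
    ring
  exact key _ _

lemma dlog_congr {g h : M → ℂ} {x : M} (e : g =ᶠ[nhds x] h) :
    dlog (E := E) g x = dlog h x := by
  unfold dlog
  rw [e.mfderiv_eq, e.eq_of_nhds]

lemma contMDiffAt_dlog {g : M → ℂ} {x : M} (hg : ContMDiffAt 𝓘(ℂ, E) 𝓘(ℂ, ℂ) ω g x)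
    (hgx : g x ≠ 0) :
    ContMDiffAt 𝓘(ℂ, E) (𝓘(ℂ, E).prod 𝓘(ℂ, E →L[ℂ] ℂ)) ω
      (fun y : M ↦ (TotalSpace.mk y (dlog g y) :
        TotalSpace (E →L[ℂ] ℂ) (CotangentSpace E M))) x := by
  have h1 : ContMDiffAt 𝓘(ℂ, E) (𝓘(ℂ, E).prod 𝓘(ℂ, E →L[ℂ] ℂ)) ω
      (fun y : M ↦ (TotalSpace.mk y (mfderiv 𝓘(ℂ, E) 𝓘(ℂ, ℂ) g y) :
        TotalSpace (E →L[ℂ] ℂ) (CotangentSpace E M))) x := by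
    refine (contMDiffAt_hom_bundle _).mpr ⟨contMDiffAt_id, ?_⟩
    have := hg.mfderiv_const (m := ω) (by simp)
    refine this.congr_of_eventuallyEq (Filter.Eventually.of_forall fun y ↦ ?_)
    apply ContinuousLinearMap.ext
    intro v
    simp only [inTangentCoordinates, ContinuousLinearMap.inCoordinates, TangentBundle.continuousLinearMapAt_model_space,
      ContinuousLinearMap.comp_apply]
    simp
    rfl
  exact (hg.inv₀ hgx).smul_section h1

variable (E M)

/-- The cover of `X` by the domains of the charts of the atlas. -/
def chartCover (i : atlas E M) : Opens M := ⟨i.1.source, i.1.open_source⟩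

lemma chartCover_iSup : ⨆ i, chartCover E M i = ⊤ := by
  refine top_unique fun x _ ↦ Opens.mem_iSup.mpr ⟨achart E x, mem_chart_source E x⟩

/-- The 1-cocycle `dlog (g i j)`, where `g i j` are the transition functions of `det 𝒯_X`. -/
def chernCocycle : oneCocycles (cotangentSheaf E M) (chartCover E M) ⊤ :=
  ⟨fun p ↦ ⟨fun x ↦ dlog (detTransition p.1 p.2) x,
    (isHolSection_iff E (fun x ↦ dlog (detTransition p.1 p.2) x) (fun _ ↦ rfl)).mpr fun x hx ↦
      contMDiffAt_dlog (contMDiffAt_detTransition p.1 p.2 hx.2.1 hx.2.2)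
        (detTransition_ne_zero p.1 p.2 hx.2.1 hx.2.2)⟩, by
    intro i j k
    refine Subtype.ext (funext fun x ↦ ?_)
    change dlog (detTransition i j) x.1 + dlog (detTransition j k) x.1 =
      dlog (detTransition i k) x.1
    have hx : ∃ hi : x.1 ∈ i.1.source, ∃ hj : x.1 ∈ j.1.source, x.1 ∈ k.1.source :=
      ⟨x.2.2.1.1, x.2.2.1.2, x.2.2.2⟩
    obtain ⟨hi, hj, hk⟩ := hx
    rw [← dlog_mul ((contMDiffAt_detTransition i j hi hj).mdifferentiableAt (by simp))
      ((contMDiffAt_detTransition j k hj hk).mdifferentiableAt (by simp))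
      (detTransition_ne_zero i j hi hj) (detTransition_ne_zero j k hj hk)]
    refine dlog_congr ?_
    filter_upwards [i.1.open_source.mem_nhds hi, j.1.open_source.mem_nhds hj,
      k.1.open_source.mem_nhds hk] with y h1 h2 h3
    exact (detTransition_mul i j k h1 h2 h3).symm⟩

/-- The first Chern class `c₁(X) = c₁(𝒯_X) = c₁(det 𝒯_X) ∈ H^1(X, Ω_X)`, i.e. the trace of the Atiyah
class of `𝒯_X`: the class of the cocycle `dlog (g i j)`, where `g i j` are the transition functions of
`det 𝒯_X`. (The convention without a factor `±1 / (2 π i)` is used.) -/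
def firstChernClass : H 1 (cotangentSheaf E M) :=
  cechClass (cotangentSheaf E M) (chartCover E M) (chartCover_iSup E M) (chernCocycle E M)

end dlog

end Holomorphic

end ComplexManifold

end

noncomputable section

namespace ComplexManifold

open CategoryTheory Limits MonoidalCategory TopologicalSpace Opposite Abelian Bundle

/-! The reason is the divergence. In a chart `i` a holomorphic vector field `v` has a divergence
`div_i v`, and Jacobi's formula for the derivative of a determinant gives `div_i v - div_j v = dlog
g_ij (v)`, with `g_ij` the Jacobian determinant of the coordinates `i` with respect to the
coordinates `j` (`divergence_eq_add`). So the Čech cocycle `dlog g_ij (v)` is the coboundary of the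
cochain `-div_i v`, naturally in `v`.

To use this in every degree `q`, the cocycle is contracted at the level of sheaves. Pairing with a
cocycle `a` of `F` is a sheaf map `G ⟶ 𝒵¹(V, K)`, and `cup_cechClass_pairing` shows that cupping
with the class of `a` and then pairing is this map followed by the connecting class of `0 → K → 𝒞⁰ →
𝒵¹ → 0`. For the Chern cocycle the map `𝒯 ⟶ 𝒵¹(V, 𝒪)` lifts through `𝒞⁰(V, 𝒪)` by `-div`
(`negDivergence_comp_cechD`), and two consecutive maps of a long exact sequence compose to zero.

The lift is `ℂ`-linear but not `𝒪`-linear; this suffices because cohomology is taken in sheaves of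
`ℂ`-vector spaces. -/

/-! ### Formal identities for Ext groups -/

/-- Associativity bookkeeping for the cup product: `l` will be the inverse unitor, `k` the tensored
section, and `h` the naturality of connecting classes. -/
lemma ext_comp_square {C : Type 1} [Category.{0} C] [Abelian C] [HasExt.{0} C]
    {A B Y Z Z' W W' : C} {q p : ℕ} (b : Ext A B q) (l : B ⟶ Y) (k : Y ⟶ Z) (e : Ext Z W p)
    (t : W ⟶ W') (u : Z ⟶ Z') (e' : Ext Z' W' p)
    (h : e.comp (Ext.mk₀ t) (add_zero p) = (Ext.mk₀ u).comp e' (zero_add p)) :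
    (b.comp ((Ext.mk₀ l).comp ((Ext.mk₀ k).comp e (zero_add p)) (zero_add p)) rfl).comp
        (Ext.mk₀ t) (add_zero (q + p)) =
      (b.comp (Ext.mk₀ (l ≫ k ≫ u)) (add_zero q)).comp e' rfl := by
  simp [h]

/-- The map `S.g` followed by the connecting class is zero, so whatever lifts to `S.X₂` dies. -/
lemma comp_mk₀_comp_extClass {C : Type 1} [Category.{0} C] [Abelian C] [HasExt.{0} C]
    {A B : C} {S : ShortComplex C} {q : ℕ} (b : Ext A B q) (f : B ⟶ S.X₂) (hS : S.ShortExact) :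
    (b.comp (Ext.mk₀ (f ≫ S.g)) (add_zero q)).comp hS.extClass rfl = 0 := by
  rw [← Ext.mk₀_comp_mk₀]
  simp [- Ext.mk₀_comp_mk₀]

/-! ### Pairings of sheaves and of presheaves -/

section Pairing

variable {X : Type} [TopologicalSpace X] {F G K : VSheaf X}

/-- The bilinear map on sections over `U` underlying a pairing of presheaves. -/
def pairingSections (m : F.obj ⊗ G.obj ⟶ K.obj) (U : Opens X) :
    F.obj.obj (op U) →ₗ[ℂ] G.obj.obj (op U) →ₗ[ℂ] K.obj.obj (op U) :=
  TensorProduct.curry (m.app (op U)).hom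

lemma res_pairingSections (m : F.obj ⊗ G.obj ⟶ K.obj) {U W : Opens X} (h : W ≤ U)
    (s : F.obj.obj (op U)) (t : G.obj.obj (op U)) :
    K.res h (pairingSections m U s t) = pairingSections m W (F.res h s) (G.res h t) :=
  (ConcreteCategory.congr_hom (m.naturality (homOfLE h).op) (s ⊗ₜ[ℂ] t)).symm

/-- A pairing of presheaves from a family of bilinear maps compatible with restriction. -/
def pairingOfSections
    (B : ∀ U : Opens X, F.obj.obj (op U) →ₗ[ℂ] G.obj.obj (op U) →ₗ[ℂ] K.obj.obj (op U))
    (hB : ∀ {U W : Opens X} (h : W ≤ U) s t, K.res h (B U s t) = B W (F.res h s) (G.res h t)) :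
    F.obj ⊗ G.obj ⟶ K.obj where
  app U := ModuleCat.ofHom (TensorProduct.lift (B U.unop))
  naturality U W f := ModuleCat.MonoidalCategory.tensor_ext fun s t ↦ (hB f.unop.le s t).symm

/-- Naturality of the sheafification adjunction in both variables lets a square be checked on
presheaves. -/
lemma whiskerRight_pairingHom {F' K' : VSheaf X} (f : F ⟶ F') (g : K ⟶ K')
    (m : F.obj ⊗ G.obj ⟶ K.obj) (m' : F'.obj ⊗ G.obj ⟶ K'.obj)
    (h : (f.hom ▷ G.obj) ≫ m' = m ≫ g.hom) : (f ▷ G) ≫ pairingHom m' = pairingHom m ≫ g := by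
  rw [pairingHom, pairingHom, ← Category.assoc, tensorIso_naturality, Category.assoc,
    Category.assoc, ← Adjunction.homEquiv_naturality_left_symm, h]
  exact congrArg _ ((sheafifyAdj X).homEquiv_naturality_right_symm m g)

/-- Maps out of a tensor product of modules are determined on pure tensors, which reduces such
squares to identities between sections. -/
lemma whiskerRight_comp_pairing {F' K' : VSheaf X} (f : F ⟶ F') (g : K ⟶ K')
    (m : F.obj ⊗ G.obj ⟶ K.obj) (m' : F'.obj ⊗ G.obj ⟶ K'.obj)
    (h : ∀ U s t, pairingSections m' U (f.hom.app (op U) s) t =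
      g.hom.app (op U) (pairingSections m U s t)) : (f.hom ▷ G.obj) ≫ m' = m ≫ g.hom := by
  ext U : 2
  exact ModuleCat.MonoidalCategory.tensor_ext fun s t ↦ h U.unop s t

/-! ### Pairings on Čech cochains and cocycles -/

variable (m : F.obj ⊗ G.obj ⟶ K.obj) {ι : Type} (V : ι → Opens X)

/-- The pairing induced on Čech 0-cochains. -/
def cechPairing : (cechSheaf F V).obj ⊗ G.obj ⟶ (cechSheaf K V).obj :=
  pairingOfSections (F := cechSheaf F V) (K := cechSheaf K V)
    (fun U ↦ LinearMap.mk₂ ℂ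
      (fun (s : ∀ i, F.obj.obj (op (U ⊓ V i))) t i ↦
        pairingSections m (U ⊓ V i) (s i) (G.res inf_le_left t))
      (fun s s' t ↦ funext fun i ↦ by
        change pairingSections m _ (s i + s' i) _ = _
        rw [map_add, LinearMap.add_apply]; rfl)
      (fun c s t ↦ funext fun i ↦ by
        change pairingSections m _ (c • s i) _ = _
        rw [map_smul, LinearMap.smul_apply]; rfl)
      (fun s t t' ↦ funext fun i ↦ by rw [map_add, map_add]; rfl)
      (fun c s t ↦ funext fun i ↦ by rw [map_smul, map_smul]; rfl))
    (fun {U W} h s t ↦ funext fun i ↦ by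
      refine (res_pairingSections m (inf_le_inf_right (V i) h) _ _).trans ?_
      change pairingSections m (W ⊓ V i) _ _ = pairingSections m (W ⊓ V i) _ (G.res _ (G.res _ t))
      rw [G.res_res, G.res_res]
      rfl)

/-- The pairing of a 1-cocycle with a section. -/
def pairCocycle (U : Opens X) (a : oneCocycles F V U) (t : G.obj.obj (op U)) :
    oneCocycles K V U :=
  ⟨fun p ↦ pairingSections m (U ⊓ (V p.1 ⊓ V p.2)) (a.1 p) (G.res inf_le_left t), by
    intro i j k
    -- Since `t` lives on all of `U`, the three terms share the same second argument on the triple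
    -- intersection, and the cocycle condition is additivity in the first.
    simp only [res_pairingSections, G.res_res]
    rw [← a.2 i j k, map_add, LinearMap.add_apply]⟩

/-- The pairing induced on Čech 1-cocycles. -/
def cocyclePairing : (cocycleSheaf F V).obj ⊗ G.obj ⟶ (cocycleSheaf K V).obj :=
  pairingOfSections (F := cocycleSheaf F V) (K := cocycleSheaf K V)
    (fun U ↦ LinearMap.mk₂ ℂ (fun (a : oneCocycles F V U) t ↦ pairCocycle m V U a t)
      (fun s s' t ↦ Subtype.ext <| funext fun i ↦ by
        change pairingSections m _ (s.1 i + s'.1 i) _ = _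
        rw [map_add, LinearMap.add_apply]; rfl)
      (fun c s t ↦ Subtype.ext <| funext fun i ↦ by
        change pairingSections m _ (c • s.1 i) _ = _
        rw [map_smul, LinearMap.smul_apply]; rfl)
      (fun s t t' ↦ Subtype.ext <| funext fun i ↦ by
        change pairingSections m _ _ (G.res _ (t + t')) = _
        rw [map_add, map_add]; rfl)
      (fun c s t ↦ Subtype.ext <| funext fun i ↦ by
        change pairingSections m _ _ (G.res _ (c • t)) = _
        rw [map_smul, map_smul]; rfl))
    (fun {U W} h s t ↦ Subtype.ext <| funext fun i ↦ by
      refine (res_pairingSections m (inf_le_inf_right _ h) _ _).trans ?_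
      change pairingSections m _ _ _ = pairingSections m _ _ (G.res _ (G.res _ t))
      rw [G.res_res, G.res_res]
      rfl)

lemma cechAug_pairing :
    ((cechAug F V).hom ▷ G.obj) ≫ cechPairing m V = m ≫ (cechAug K V).hom :=
  whiskerRight_comp_pairing _ _ _ _ fun _ s t ↦ funext fun _ ↦
    (res_pairingSections m inf_le_left s t).symm

/-- Both terms of the coboundary are paired with the same restriction of `t`, so linearity in the
first variable suffices. -/
lemma pairCocycle_cechD (U : Opens X) (s : ∀ i, F.obj.obj (op (U ⊓ V i)))
    (t : G.obj.obj (op U)) :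
    pairCocycle m V U ((cechD F V).hom.app (op U) s) t =
      (cechD K V).hom.app (op U)
        (fun i ↦ pairingSections m (U ⊓ V i) (s i) (G.res inf_le_left t)) := by
  refine Subtype.ext (funext fun p ↦ ?_)
  rw [cechD_apply K V U _ p.1 p.2, res_pairingSections, res_pairingSections, G.res_res, G.res_res]
  refine (congrArg (fun w ↦ pairingSections m _ w _) (cechD_apply F V U s p.1 p.2)).trans ?_
  rw [map_sub, LinearMap.sub_apply]

lemma cechD_pairing :
    ((cechD F V).hom ▷ G.obj) ≫ cocyclePairing m V = cechPairing m V ≫ (cechD K V).hom :=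
  whiskerRight_comp_pairing _ _ _ _ fun U s t ↦ pairCocycle_cechD m V U s t

/-- The morphism of short exact sequences induced by a pairing. -/
def cechSESPairing : (cechSES F V).map (tensorRight G) ⟶ cechSES K V where
  τ₁ := pairingHom m
  τ₂ := pairingHom (cechPairing m V)
  τ₃ := pairingHom (cocyclePairing m V)
  comm₁₂ := (whiskerRight_pairingHom _ _ _ _ (cechAug_pairing m V)).symm
  comm₂₃ := (whiskerRight_pairingHom _ _ _ _ (cechD_pairing m V)).symm

/-- The morphism `G ⟶ K` given by pairing with a global section of `F`. -/
def pairSection (s : F.obj.obj (op ⊤)) : G ⟶ K where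
  hom :=
    { app U := ModuleCat.ofHom (pairingSections m U.unop (F.res le_top s))
      naturality {U W} f := by
        refine ConcreteCategory.hom_ext _ _ fun t ↦ ?_
        refine Eq.trans ?_ (res_pairingSections m f.unop.le (F.res le_top s) t).symm
        rw [F.res_res]
        rfl }

/-! ### The tensor unit and global sections -/

lemma leftUnitor_sheafify_hom (P : (Opens X)ᵒᵖ ⥤ ModuleCat.{0} ℂ) :
    (λ_ ((sheafify X).obj P)).hom =
      Functor.LaxMonoidal.μ (sheafify X) (𝟙_ _) P ≫ (sheafify X).map (λ_ P).hom := by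
  have h := Functor.LaxMonoidal.left_unitality (sheafify X) P
  -- The unit of `VSheaf X` is by construction the sheafification of the presheaf unit.
  have e : Functor.LaxMonoidal.ε (sheafify X) = 𝟙 _ := rfl
  rw [e, MonoidalCategory.id_whiskerRight] at h
  exact h.trans (Category.id_comp _)

/-- Transports the previous identity along the isomorphism of `G` with its sheafification, in the
shape produced by unfolding `tensorSheafIso`. -/
lemma leftUnitor_inv_tensor (G : VSheaf X) :
    (λ_ G).inv ≫ ((sheafify X).obj (𝟙_ _) ◁ (sheafifySelfIso G).inv) ≫
      Functor.LaxMonoidal.μ (sheafify X) (𝟙_ _) G.obj =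
    (sheafifySelfIso G).inv ≫ (sheafify X).map (λ_ G.obj).inv := by
  have h := leftUnitor_inv_naturality (sheafifySelfIso G).inv
  have h' := leftUnitor_sheafify_hom G.obj
  have h'' : Functor.LaxMonoidal.μ (sheafify X) (𝟙_ _) G.obj =
      (λ_ ((sheafify X).obj G.obj)).hom ≫ (sheafify X).map (λ_ G.obj).inv := by
    rw [h', Category.assoc, ← Functor.map_comp, Iso.hom_inv_id, CategoryTheory.Functor.map_id, Category.comp_id]
  rw [h'']
  have h3 : (λ_ G).inv ≫ ((sheafify X).obj (𝟙_ _) ◁ (sheafifySelfIso G).inv) =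
    (sheafifySelfIso G).inv ≫ (λ_ ((sheafify X).obj G.obj)).inv := h.symm
  rw [← Category.assoc, h3, Category.assoc, Iso.inv_hom_id_assoc]

/-- The section `s` is the transpose of `1 ↦ s`. Transposing the composite `G = ℂ_X ⊗ G → F ⊗ G → K`
as well leaves a comparison of presheaf maps out of `G.obj`. -/
lemma globalSectionHom_pairing (s : F.obj.obj (op ⊤)) :
    (λ_ G).inv ≫ ((show 𝟙_ (VSheaf X) ⟶ F from globalSectionHom F s) ▷ G) ≫ pairingHom m =
      pairSection m s := by
  have h1 : ∀ g : 𝟙_ ((Opens X)ᵒᵖ ⥤ ModuleCat.{0} ℂ) ⟶ F.obj,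
      (((sheafifyAdj X).homEquiv _ _).symm g ▷ G) ≫ (tensorSheafIso F G).hom =
      ((sheafify X).obj (𝟙_ _) ◁ (sheafifySelfIso G).inv) ≫
        Functor.LaxMonoidal.μ (sheafify X) (𝟙_ _) G.obj ≫ (sheafify X).map (g ▷ G.obj) := by
    intro g
    -- The counit appearing here cancels against its inverse inside `tensorSheafIso`.
    have e : ((sheafifyAdj X).homEquiv _ _).symm g =
        (sheafify X).map g ≫ (sheafifySelfIso F).hom :=
      (sheafifyAdj X).homEquiv_counit _ _ g
    rw [e, tensorSheafIso, ← Functor.LaxMonoidal.μ_natural_left]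
    simp only [Iso.trans_hom, Functor.Monoidal.μIso_hom, MonoidalCategory.tensorIso_hom,
      Iso.symm_hom]
    rw [← Category.assoc, ← Category.assoc, ← tensorHom_id, tensorHom_comp_tensorHom,
      Category.assoc, Iso.hom_inv_id, Category.comp_id, Category.id_comp,
      ← tensorHom_def']
  have h2 : ∀ g : 𝟙_ ((Opens X)ᵒᵖ ⥤ ModuleCat.{0} ℂ) ⟶ F.obj,
      (λ_ G).inv ≫ (((sheafifyAdj X).homEquiv _ _).symm g ▷ G) ≫ pairingHom m =
        (sheafifySelfIso G).inv ≫ ((sheafifyAdj X).homEquiv _ _).symm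
          ((λ_ G.obj).inv ≫ (g ▷ G.obj) ≫ m) := by
    intro g
    rw [pairingHom, reassoc_of% (h1 g), reassoc_of% (leftUnitor_inv_tensor G),
      Adjunction.homEquiv_naturality_left_symm, Adjunction.homEquiv_naturality_left_symm]
  refine (h2 _).trans ?_
  rw [Iso.inv_comp_eq]
  have h3 := (sheafifyAdj X).homEquiv_naturality_right_symm (𝟙 G.obj) (pairSection m s)
  have h4 : ((sheafifyAdj X).homEquiv _ _).symm (𝟙 G.obj) = (sheafifySelfIso G).hom := by
    rw [Adjunction.homEquiv_counit, CategoryTheory.Functor.map_id]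
    exact Category.id_comp _
  rw [h4] at h3
  rw [← h3]
  refine congrArg _ ?_
  rw [Category.id_comp]
  ext U t
  -- The scalar `1` is the one inserted by the inverse left unitor.
  change m.app U ((1 : ℂ) • F.res le_top s ⊗ₜ[ℂ] t) = m.app U (F.res le_top s ⊗ₜ[ℂ] t)
  rw [one_smul]

/-- The exact functor `- ⊗ G` carries the connecting class of `S` to that of the tensored sequence,
and naturality along `φ` replaces the latter by the class of `S'`. -/
lemma cup_extClass_comp {S S' : ShortComplex (VSheaf X)} (hS : S.ShortExact)
    (hS' : S'.ShortExact) (f : 𝟙_ (VSheaf X) ⟶ S.X₃) (φ : S.map (tensorRight G) ⟶ S') {q : ℕ}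
    (b : H q G) :
    (cup (F := S.X₁) ((Ext.mk₀ f).comp hS.extClass (zero_add 1)) b).comp
        (Ext.mk₀ φ.τ₁) (add_zero (q + 1)) =
      (b.comp (Ext.mk₀ ((λ_ G).inv ≫ (f ▷ G) ≫ φ.τ₃)) (add_zero q)).comp
        hS'.extClass rfl := by
  have h1 : Ext.mapExactFunctor (tensorRight G) ((Ext.mk₀ f).comp hS.extClass (zero_add 1)) =
      (Ext.mk₀ (f ▷ G)).comp (hS.map_of_exact (tensorRight G)).extClass (zero_add 1) := by
    rw [Ext.mapExactFunctor_comp, Ext.mapExactFunctor_mk₀, Ext.mapExactFunctor_extClass]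
    rfl
  have h2 := ShortComplex.ShortExact.extClass_naturality (hS.map_of_exact (tensorRight G)) hS' φ
  have h3 := ext_comp_square b (λ_ G).inv (f ▷ G) _ _ _ _ h2
  rw [← h1] at h3
  exact h3

theorem cup_cechClass_pairing (hV : ⨆ i, V i = ⊤) (a : oneCocycles F V ⊤) {q : ℕ} (b : H q G) :
    (cup (cechClass F V hV a) b).comp (Ext.mk₀ (pairingHom m)) (add_zero (q + 1)) =
      (b.comp (Ext.mk₀ (pairSection (cocyclePairing m V) a)) (add_zero q)).comp
        (cechSES_shortExact K V hV).extClass rfl := by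
  refine (cup_extClass_comp (cechSES_shortExact F V hV) (cechSES_shortExact K V hV)
    (globalSectionHom (cocycleSheaf F V) a) (cechSESPairing m V) b).trans ?_
  exact congrArg (fun w ↦ (b.comp (Ext.mk₀ w) (add_zero q)).comp
    (cechSES_shortExact K V hV).extClass rfl) (globalSectionHom_pairing (cocyclePairing m V) a)

end Pairing

/-! ### Jacobi's formula and change of coordinates -/

section Divergence

variable {E : Type} [NormedAddCommGroup E] [NormedSpace ℂ E] [FiniteDimensional ℂ E]

/-- The trace as a continuous linear map. -/
def traceCLM (E : Type) [NormedAddCommGroup E] [NormedSpace ℂ E] [FiniteDimensional ℂ E] :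
    (E →L[ℂ] E) →L[ℂ] ℂ :=
  LinearMap.toContinuousLinearMap
    ((LinearMap.trace ℂ E).comp (ContinuousLinearMap.coeLM ℂ (M := E) (N₃ := E)))

lemma traceCLM_apply (f : E →L[ℂ] E) : traceCLM E f = LinearMap.trace ℂ E f := rfl

lemma traceCLM_comp_comm (f g : E →L[ℂ] E) : traceCLM E (f ∘L g) = traceCLM E (g ∘L f) :=
  LinearMap.trace_mul_comm ℂ (f : E →ₗ[ℂ] E) (g : E →ₗ[ℂ] E)

lemma det_comp (f g : E →L[ℂ] E) : (f ∘L g).det = f.det * g.det :=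
  LinearMap.det_comp (f : E →ₗ[ℂ] E) (g : E →ₗ[ℂ] E)

lemma differentiable_det : Differentiable ℂ (fun f : E →L[ℂ] E ↦ f.det) :=
  contDiff_det.differentiable (by simp)

/-- In a basis, `det (1 + tH)` is a polynomial in `t` whose linear coefficient is the trace of `H`;
the chain rule along this line gives the derivative. -/
lemma fderiv_det_id (H : E →L[ℂ] E) :
    fderiv ℂ (fun f : E →L[ℂ] E ↦ f.det) (ContinuousLinearMap.id ℂ E) H = traceCLM E H := by
  let b := Module.finBasis ℂ E
  let M := LinearMap.toMatrix b b (H : E →ₗ[ℂ] E)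
  let p : Polynomial ℂ := Matrix.det (1 + (Polynomial.X : Polynomial ℂ) • M.map Polynomial.C)
  have hp (t : ℂ) : (ContinuousLinearMap.id ℂ E + t • H).det = p.eval t := by
    rw [ContinuousLinearMap.det, ← LinearMap.det_toMatrix b]
    have : LinearMap.toMatrix b b ((ContinuousLinearMap.id ℂ E + t • H : E →L[ℂ] E) : E →ₗ[ℂ] E) =
        1 + t • M := by
      rw [ContinuousLinearMap.toLinearMap_add, map_add, ContinuousLinearMap.toLinearMap_smul, map_smul]
      congr 1
      exact LinearMap.toMatrix_one b
    rw [this, ← Polynomial.coe_evalRingHom, RingHom.map_det]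
    congr 1
    ext i j
    by_cases h : i = j <;> simp [h] <;> exact mul_comm _ _
  have h1 : HasDerivAt (fun t : ℂ ↦ (ContinuousLinearMap.id ℂ E + t • H).det)
      (fderiv ℂ (fun f : E →L[ℂ] E ↦ f.det) (ContinuousLinearMap.id ℂ E) H) 0 := by
    have h := (differentiable_det (ContinuousLinearMap.id ℂ E)).hasFDerivAt
    have hl : HasDerivAt (fun t : ℂ ↦ ContinuousLinearMap.id ℂ E + t • H) H 0 := by
      simpa using ((hasDerivAt_id (0 : ℂ)).smul_const H).const_add (ContinuousLinearMap.id ℂ E)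
    have h0 : ContinuousLinearMap.id ℂ E = ContinuousLinearMap.id ℂ E + (0 : ℂ) • H := by simp
    rw [h0] at h
    have := h.comp_hasDerivAt (0 : ℂ) hl
    rwa [← h0] at this
  have h2 := p.hasDerivAt 0
  simp only [hp] at h1
  rw [h1.unique h2, Matrix.derivative_det_one_add_X_smul, traceCLM_apply,
    LinearMap.trace_eq_matrix_trace ℂ b]

/-- Jacobi's formula for the derivative of the determinant. -/
lemma fderiv_det (A B H : E →L[ℂ] E) (hAB : A ∘L B = ContinuousLinearMap.id ℂ E)
    (hBA : B ∘L A = ContinuousLinearMap.id ℂ E) :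
    fderiv ℂ (fun f : E →L[ℂ] E ↦ f.det) A H = A.det * traceCLM E (B ∘L H) := by
  -- Writing `f = A ∘ (B ∘ f)` moves the base point from `A` to `B ∘ A = id`.
  have e : (fun f : E →L[ℂ] E ↦ f.det) =
      fun f ↦ A.det * (fun f : E →L[ℂ] E ↦ f.det) (ContinuousLinearMap.compL ℂ E E E B f) := by
    funext f
    rw [ContinuousLinearMap.compL_apply, ← det_comp, ← ContinuousLinearMap.comp_assoc, hAB,
      ContinuousLinearMap.id_comp]
  have h := (((differentiable_det (B ∘L A)).hasFDerivAt.comp A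
    (ContinuousLinearMap.compL ℂ E E E B).hasFDerivAt).const_mul A.det).fderiv
  rw [e]
  refine (congrArg (· H) h).trans ?_
  rw [hBA]
  exact congrArg (A.det * ·) (fderiv_det_id (B ∘L H))

/-- The change of the divergence of a vector field under a change of coordinates `ψ`. -/
lemma trace_fderiv_of_pushforward {ψ V W : E → E} {y : E} {B : E →L[ℂ] E}
    (hψ : ContDiffAt ℂ ω ψ y) (hV : DifferentiableAt ℂ V y) (hW : DifferentiableAt ℂ W (ψ y))
    (hAB : fderiv ℂ ψ y ∘L B = ContinuousLinearMap.id ℂ E)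
    (hBA : B ∘L fderiv ℂ ψ y = ContinuousLinearMap.id ℂ E)
    (h : ∀ᶠ z in nhds y, W (ψ z) = fderiv ℂ ψ z (V z)) :
    traceCLM E (fderiv ℂ W (ψ y)) = traceCLM E (fderiv ℂ V y) +
      (fderiv ℂ ψ y).det⁻¹ * fderiv ℂ (fun z ↦ (fderiv ℂ ψ z).det) y (V y) := by
  have hψ1 : DifferentiableAt ℂ ψ y := hψ.differentiableAt (by simp)
  have hψ2 : DifferentiableAt ℂ (fderiv ℂ ψ) y :=
    (hψ.fderiv_right (m := ω) (by simp)).differentiableAt (by simp)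
  set A := fderiv ℂ ψ y with hA
  set C := fderiv ℂ (fderiv ℂ ψ) y (V y) with hC
  -- Differentiate `W ∘ ψ = Dψ · V`. The second-order term is `w ↦ D²ψ(w, V)`, which symmetry of
  -- `D²ψ` turns into `C`.
  have e1 : fderiv ℂ W (ψ y) ∘L A = C + A ∘L fderiv ℂ V y := by
    have h1 := (hW.hasFDerivAt.comp y hψ1.hasFDerivAt).fderiv
    have h2 := (hψ2.hasFDerivAt.clm_apply hV.hasFDerivAt).fderiv
    have h3 : W ∘ ψ =ᶠ[nhds y] fun z ↦ fderiv ℂ ψ z (V z) := h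
    rw [← h1, h3.fderiv_eq, h2]
    ext w
    simp only [add_apply, ContinuousLinearMap.comp_apply,
      ContinuousLinearMap.flip_apply]
    rw [hC, hψ.isSymmSndFDerivAt_of_omega.eq (V y) w, add_comm]
  have e2 : fderiv ℂ W (ψ y) = (C + A ∘L fderiv ℂ V y) ∘L B := by
    rw [← e1, ContinuousLinearMap.comp_assoc, hAB, ContinuousLinearMap.comp_id]
  -- By Jacobi's formula the trace of `B ∘ C` is the logarithmic derivative of `det Dψ` along `V`.
  have e3 : fderiv ℂ (fun z ↦ (fderiv ℂ ψ z).det) y (V y) = A.det * traceCLM E (B ∘L C) := by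
    have h1 := ((differentiable_det A).hasFDerivAt.comp y hψ2.hasFDerivAt).fderiv
    rw [← fderiv_det A B C hAB hBA]
    exact congrArg (· (V y)) h1
  have e4 : A.det ≠ 0 := fun h0 ↦ by
    have := det_comp A B
    rw [hAB, h0, zero_mul] at this
    exact one_ne_zero (LinearMap.det_id.symm.trans this)
  -- Cyclicity of the trace moves `B` to the left, where it cancels `A` in front of `DV`.
  rw [e2, traceCLM_comp_comm, e3, inv_mul_cancel_left₀ e4, ContinuousLinearMap.comp_add, map_add,
    ← ContinuousLinearMap.comp_assoc, hBA, ContinuousLinearMap.id_comp, add_comm]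

/-! ### Divergence of a vector field in a chart -/

variable {M : Type} [TopologicalSpace M] [ChartedSpace E M] [IsManifold 𝓘(ℂ, E) ω M]

lemma coordChange_eq_fderiv (i j : atlas E M) (x : M) :
    (tangentBundleCore 𝓘(ℂ, E) M).coordChange i j x = fderiv ℂ (j.1 ∘ i.1.symm) (i.1 x) := by
  rw [tangentBundleCore_coordChange]
  simp [mfld_simps]

/-- A vector field in the coordinates given by the chart `i`. -/
def coordField (i : atlas E M) (v : ∀ x : M, TangentSpace 𝓘(ℂ, E) x) (x : M) : E :=
  -- A tangent vector at `x` is stored as its coordinates in the preferred chart at `x`.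
  (tangentBundleCore 𝓘(ℂ, E) M).coordChange (achart E x) i x (v x)

/-- `coordField i v` is the fibre coordinate of `v` in the local trivialization of chart `i`, and
regularity of a section can be tested there. -/
lemma contMDiffAt_coordField (i : atlas E M) {v : ∀ x : M, TangentSpace 𝓘(ℂ, E) x} {x : M}
    (hx : x ∈ i.1.source)
    (hv : ContMDiffAt 𝓘(ℂ, E) (𝓘(ℂ, E).prod 𝓘(ℂ, E)) ω
      (fun x : M ↦ (TotalSpace.mk x (v x) :
        TotalSpace E (TangentSpace 𝓘(ℂ, E) : M → Type))) x) :
    ContMDiffAt 𝓘(ℂ, E) 𝓘(ℂ, E) ω (coordField i v) x := by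
  have : IsManifold 𝓘(ℂ, E) (ω + 1) M := by simpa
  let e : Trivialization E (TotalSpace.proj : TotalSpace E (TangentSpace 𝓘(ℂ, E) : M → Type) → M) :=
    (tangentBundleCore 𝓘(ℂ, E) M).localTriv i
  have : MemTrivializationAtlas e := ⟨⟨i, rfl⟩⟩
  exact (e.contMDiffAt_section_iff hx).mp hv

lemma contDiffAt_comp_chart_symm {F : Type} [NormedAddCommGroup F] [NormedSpace ℂ F]
    (j : atlas E M) {g : M → F} {x : M} (hx : x ∈ j.1.source)
    (hg : ContMDiffAt 𝓘(ℂ, E) 𝓘(ℂ, F) ω g x) : ContDiffAt ℂ ω (g ∘ j.1.symm) (j.1 x) := by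
  rw [← contMDiffAt_iff_contDiffAt]
  refine ContMDiffAt.comp (I' := 𝓘(ℂ, E)) _ ?_ (contMDiffAt_symm_of_mem_maximalAtlas
    (IsManifold.subset_maximalAtlas j.2) (j.1.map_source hx))
  rwa [j.1.left_inv hx]

lemma tendsto_chart_symm (j : atlas E M) {x : M} (hx : x ∈ j.1.source) :
    Filter.Tendsto j.1.symm (nhds (j.1 x)) (nhds x) := by
  have := j.1.continuousAt_symm (j.1.map_source hx)
  rwa [ContinuousAt, j.1.left_inv hx] at this

lemma contDiffAt_coordField (i : atlas E M) {v : ∀ x : M, TangentSpace 𝓘(ℂ, E) x} {x : M}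
    (hx : x ∈ i.1.source)
    (hv : ContMDiffAt 𝓘(ℂ, E) (𝓘(ℂ, E).prod 𝓘(ℂ, E)) ω
      (fun x : M ↦ (TotalSpace.mk x (v x) :
        TotalSpace E (TangentSpace 𝓘(ℂ, E) : M → Type))) x) :
    ContDiffAt ℂ ω (coordField i v ∘ i.1.symm) (i.1 x) :=
  contDiffAt_comp_chart_symm i hx (contMDiffAt_coordField i hx hv)

/-- The divergence of a vector field with respect to the coordinates given by the chart `i`. -/
def divergence (i : atlas E M) (v : ∀ x : M, TangentSpace 𝓘(ℂ, E) x) (x : M) : ℂ :=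
  traceCLM E (fderiv ℂ (coordField i v ∘ i.1.symm) (i.1 x))

lemma contMDiffAt_divergence (i : atlas E M) {v : ∀ x : M, TangentSpace 𝓘(ℂ, E) x} {x : M}
    (hx : x ∈ i.1.source)
    (hv : ContMDiffAt 𝓘(ℂ, E) (𝓘(ℂ, E).prod 𝓘(ℂ, E)) ω
      (fun x : M ↦ (TotalSpace.mk x (v x) :
        TotalSpace E (TangentSpace 𝓘(ℂ, E) : M → Type))) x) :
    ContMDiffAt 𝓘(ℂ, E) 𝓘(ℂ, ℂ) ω (divergence i v) x := by
  have h : ContDiffAt ℂ ω (fun y ↦ traceCLM E (fderiv ℂ (coordField i v ∘ i.1.symm) y)) (i.1 x) :=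
    (traceCLM E).contDiff.contDiffAt.comp _
      ((contDiffAt_coordField i hx hv).fderiv_right (m := ω) (by simp))
  exact h.contMDiffAt.comp x
    (contMDiffAt_of_mem_maximalAtlas (IsManifold.subset_maximalAtlas i.2) hx)

/-- Locality makes the divergence of an extension by zero independent, at points of the smaller open
set, of which open set one extends from. -/
lemma divergence_congr (i : atlas E M) {v w : ∀ x : M, TangentSpace 𝓘(ℂ, E) x} {x : M}
    (hx : x ∈ i.1.source) (h : ∀ᶠ y in nhds x, v y = w y) :
    divergence i v x = divergence i w x := by
  have e : coordField i v ∘ i.1.symm =ᶠ[nhds (i.1 x)] coordField i w ∘ i.1.symm := by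
    filter_upwards [(tendsto_chart_symm i hx).eventually h] with z hz
    simp only [Function.comp_apply, coordField, hz]
  rw [divergence, divergence, e.fderiv_eq]

lemma divergence_add (i : atlas E M) {v w : ∀ x : M, TangentSpace 𝓘(ℂ, E) x} {x : M}
    (hx : x ∈ i.1.source)
    (hv : ContMDiffAt 𝓘(ℂ, E) (𝓘(ℂ, E).prod 𝓘(ℂ, E)) ω
      (fun x : M ↦ (TotalSpace.mk x (v x) :
        TotalSpace E (TangentSpace 𝓘(ℂ, E) : M → Type))) x)
    (hw : ContMDiffAt 𝓘(ℂ, E) (𝓘(ℂ, E).prod 𝓘(ℂ, E)) ω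
      (fun x : M ↦ (TotalSpace.mk x (w x) :
        TotalSpace E (TangentSpace 𝓘(ℂ, E) : M → Type))) x) :
    divergence i (v + w) x = divergence i v x + divergence i w x := by
  have e : coordField i (v + w) ∘ i.1.symm =
      coordField i v ∘ i.1.symm + coordField i w ∘ i.1.symm := by
    funext z
    exact map_add _ _ _
  rw [divergence, e, fderiv_add ((contDiffAt_coordField i hx hv).differentiableAt (by simp))
    ((contDiffAt_coordField i hx hw).differentiableAt (by simp)), map_add]
  rfl

lemma divergence_smul (i : atlas E M) (c : ℂ) (v : ∀ x : M, TangentSpace 𝓘(ℂ, E) x) (x : M) :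
    divergence i (c • v) x = c * divergence i v x := by
  have e : coordField i (c • v) ∘ i.1.symm = c • (coordField i v ∘ i.1.symm) := by
    funext z
    exact map_smul _ c _
  rw [divergence, e, fderiv_const_smul_field]
  exact map_smul (traceCLM E) c _

/-- `mfderiv` is computed in the preferred chart at `x`; the chain rule through the transition map
moves it to chart `j`. -/
lemma mfderiv_apply_eq_coordField (j : atlas E M) {g : M → ℂ} {x : M} (hx : x ∈ j.1.source)
    (hg : ContMDiffAt 𝓘(ℂ, E) 𝓘(ℂ, ℂ) ω g x) (v : ∀ x : M, TangentSpace 𝓘(ℂ, E) x) :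
    mfderiv 𝓘(ℂ, E) 𝓘(ℂ, ℂ) g x (v x) = fderiv ℂ (g ∘ j.1.symm) (j.1 x) (coordField j v x) := by
  let k := achart E x
  have hk : x ∈ k.1.source := mem_chart_source E x
  have e1 : mfderiv 𝓘(ℂ, E) 𝓘(ℂ, ℂ) g x = fderiv ℂ (g ∘ k.1.symm) (k.1 x) := by
    refine (hg.mdifferentiableAt (by simp)).mfderiv.trans ?_
    simp [mfld_simps, writtenInExtChartAt, k]
    rfl
  have e2 : g ∘ k.1.symm =ᶠ[nhds (k.1 x)] (g ∘ j.1.symm) ∘ (j.1 ∘ k.1.symm) := by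
    filter_upwards [(tendsto_chart_symm k hk).eventually (j.1.open_source.mem_nhds hx)] with z hz
    simp only [Function.comp_apply]
    rw [j.1.left_inv hz]
  have hj : ContMDiffAt 𝓘(ℂ, E) 𝓘(ℂ, E) ω j.1 x :=
    contMDiffAt_of_mem_maximalAtlas (IsManifold.subset_maximalAtlas j.2) hx
  have e3 : (j.1 ∘ k.1.symm) (k.1 x) = j.1 x := congrArg j.1 (k.1.left_inv hk)
  have e4 : fderiv ℂ ((g ∘ j.1.symm) ∘ (j.1 ∘ k.1.symm)) (k.1 x) =
      fderiv ℂ (g ∘ j.1.symm) (j.1 x) ∘L fderiv ℂ (j.1 ∘ k.1.symm) (k.1 x) := by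
    rw [fderiv_comp _ (by
      rw [e3]; exact (contDiffAt_comp_chart_symm j hx hg).differentiableAt (by simp))
      ((contDiffAt_comp_chart_symm k hk hj).differentiableAt (by simp)), e3]
  rw [coordField, coordChange_eq_fderiv]
  exact congrArg (· (v x)) (e1.trans (e2.fderiv_eq.trans e4))

lemma coordChange_comp_self (i j : atlas E M) {x : M} (hi : x ∈ i.1.source)
    (hj : x ∈ j.1.source) :
    (tangentBundleCore 𝓘(ℂ, E) M).coordChange i j x ∘L
      (tangentBundleCore 𝓘(ℂ, E) M).coordChange j i x = ContinuousLinearMap.id ℂ E := by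
  ext w
  exact ((tangentBundleCore 𝓘(ℂ, E) M).coordChange_comp j i j x ⟨⟨hj, hi⟩, hj⟩ w).trans
    ((tangentBundleCore 𝓘(ℂ, E) M).coordChange_self j x hj w)

/-- The heart of the proof: the transformation law `trace_fderiv_of_pushforward` for `ψ = i ∘ j⁻¹`,
whose Jacobian determinant is `detTransition i j` read in chart `j`. -/
lemma divergence_eq_add (i j : atlas E M) {v : ∀ x : M, TangentSpace 𝓘(ℂ, E) x} {x : M}
    (hi : x ∈ i.1.source) (hj : x ∈ j.1.source)
    (hv : ContMDiffAt 𝓘(ℂ, E) (𝓘(ℂ, E).prod 𝓘(ℂ, E)) ω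
      (fun x : M ↦ (TotalSpace.mk x (v x) :
        TotalSpace E (TangentSpace 𝓘(ℂ, E) : M → Type))) x) :
    divergence i v x = divergence j v x + dlog (detTransition i j) x (v x) := by
  have hψ : ContDiffAt ℂ ω (i.1 ∘ j.1.symm) (j.1 x) := contDiffAt_comp_chart_symm j hj
    (contMDiffAt_of_mem_maximalAtlas (IsManifold.subset_maximalAtlas i.2) hi)
  have hψx : (i.1 ∘ j.1.symm) (j.1 x) = i.1 x := congrArg i.1 (j.1.left_inv hj)
  have hnear : ∀ᶠ z in nhds (j.1 x), j.1.symm z ∈ i.1.source ∧ j.1.symm z ∈ j.1.source ∧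
      j.1 (j.1.symm z) = z := by
    filter_upwards [(tendsto_chart_symm j hj).eventually (i.1.open_source.mem_nhds hi),
      (tendsto_chart_symm j hj).eventually (j.1.open_source.mem_nhds hj),
      j.1.open_target.mem_nhds (j.1.map_source hj)] with z h1 h2 h3
    exact ⟨h1, h2, j.1.right_inv h3⟩
  have h := trace_fderiv_of_pushforward (ψ := i.1 ∘ j.1.symm) (V := coordField j v ∘ j.1.symm)
    (W := coordField i v ∘ i.1.symm) (y := j.1 x)
    (B := (tangentBundleCore 𝓘(ℂ, E) M).coordChange i j x) hψ
    ((contDiffAt_coordField j hj hv).differentiableAt (by simp))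
    (by rw [hψx]; exact (contDiffAt_coordField i hi hv).differentiableAt (by simp))
    (by rw [← coordChange_eq_fderiv]; exact coordChange_comp_self j i hj hi)
    (by rw [← coordChange_eq_fderiv]; exact coordChange_comp_self i j hi hj) (by
      filter_upwards [hnear] with z hz
      have e := coordChange_eq_fderiv j i (j.1.symm z)
      rw [hz.2.2] at e
      rw [← e]
      simp only [Function.comp_apply]
      rw [i.1.left_inv hz.1]
      -- Passing from the preferred chart to `j` and then to `i` agrees with passing directly to
      -- `i`.
      exact ((tangentBundleCore 𝓘(ℂ, E) M).coordChange_comp (achart E (j.1.symm z)) j i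
        (j.1.symm z) ⟨⟨mem_chart_source E _, hz.2.1⟩, hz.1⟩ _).symm)
  have hdet : detTransition i j ∘ j.1.symm =ᶠ[nhds (j.1 x)]
      fun z ↦ (fderiv ℂ (i.1 ∘ j.1.symm) z).det := by
    filter_upwards [hnear] with z hz
    rw [Function.comp_apply, detTransition, coordChange_eq_fderiv, hz.2.2]
  rw [hψx] at h
  have hm := mfderiv_apply_eq_coordField j hj (contMDiffAt_detTransition i j hi hj) v
  rw [hdet.fderiv_eq] at hm
  refine h.trans (congrArg (divergence j v x + ·) (Eq.trans ?_
    (congrArg (fun w : ℂ ↦ (detTransition i j x)⁻¹ * w) hm.symm)))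
  simp only [detTransition, coordChange_eq_fderiv, Function.comp_apply, j.1.left_inv hj]

end Divergence

/-! ### Vanishing of the contraction with the Chern class -/

section ChernContraction

variable {E : Type} [NormedAddCommGroup E] [NormedSpace ℂ E] [FiniteDimensional ℂ E]
  {M : Type} [TopologicalSpace M] [ChartedSpace E M] [IsManifold 𝓘(ℂ, E) ω M]

/-- The holomorphic function `-div v` in the coordinates given by the chart `i`. -/
def negDivergenceSection (U : Opens M) (i : atlas E M) :
    holSubmodule E E (TangentSpace 𝓘(ℂ, E) : M → Type) U →ₗ[ℂ]
      holSubmodule E ℂ (Bundle.Trivial M ℂ) (U ⊓ chartCover E M i) where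
  toFun s := ⟨fun x ↦ (-divergence i (zeroExt s.1) x.1 : ℂ), by
    refine isHolSection_trivial_iff.mpr fun x ↦ ?_
    have hs := (isHolSection_iff E _ (zeroExt_apply s.1)).mp s.2 x.1 x.2.1
    exact (contMDiffAt_subtype_iff (x := x)
      (f := fun x : M ↦ -divergence i (zeroExt s.1) x)).mpr
        (contMDiffAt_divergence i x.2.2 hs).neg⟩
  map_add' s t := Subtype.ext <| funext fun x ↦ by
    have hs := (isHolSection_iff E _ (zeroExt_apply s.1)).mp s.2 x.1 x.2.1
    have ht := (isHolSection_iff E _ (zeroExt_apply t.1)).mp t.2 x.1 x.2.1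
    have e : zeroExt (s + t).1 = zeroExt s.1 + zeroExt t.1 := by
      funext y
      by_cases h : y ∈ U <;> simp [zeroExt, h]
    change -divergence i (zeroExt (s + t).1) x.1 =
      -divergence i (zeroExt s.1) x.1 + -divergence i (zeroExt t.1) x.1
    rw [e, divergence_add i x.2.2 hs ht, neg_add]
  map_smul' c s := Subtype.ext <| funext fun x ↦ by
    have e : zeroExt (c • s).1 = c • zeroExt s.1 := by
      funext y
      by_cases h : y ∈ U <;> simp [zeroExt, h]
    change -divergence i (zeroExt (c • s).1) x.1 = c * -divergence i (zeroExt s.1) x.1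
    rw [e, divergence_smul, mul_neg]

variable (E M) in
/-- The `ℂ`-linear morphism `𝒯_X ⟶ 𝒞⁰(V, 𝒪_X)` given by the divergences `-div v` in the charts. -/
def negDivergence :
    tangentSheaf E M ⟶ cechSheaf (structureSheaf E M) (chartCover E M) where
  hom :=
    { app U := ModuleCat.ofHom (LinearMap.pi fun i ↦ negDivergenceSection U.unop i)
      naturality {U W} f := by
        refine ConcreteCategory.hom_ext _ _ fun s ↦ funext fun i ↦ Subtype.ext <| funext fun x ↦ ?_
        refine congrArg Neg.neg (divergence_congr i x.2.2 ?_)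
        filter_upwards [W.unop.isOpen.mem_nhds x.2.1] with y hy
        exact (zeroExt_apply _ ⟨y, hy⟩).symm.trans (zeroExt_apply s.1 ⟨y, f.unop.le hy⟩) }

/-- The coboundary is `s j - s i`, so the sign in `-div` yields `div_i v - div_j v`, which is `dlog
g_ij (v)`. -/
lemma negDivergence_comp_cechD :
    negDivergence E M ≫ cechD (structureSheaf E M) (chartCover E M) =
      pairSection (cocyclePairing (contractPresheaf E M) (chartCover E M)) (chernCocycle E M) := by
  apply ObjectProperty.hom_ext
  ext U : 2
  refine ConcreteCategory.hom_ext _ _ fun s ↦ Subtype.ext <| funext fun p ↦ Subtype.ext <|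
    funext fun x ↦ ?_
  have hs := (isHolSection_iff E _ (zeroExt_apply s.1)).mp s.2 x.1 x.2.1
  have h := divergence_eq_add p.1 p.2 x.2.2.1 x.2.2.2 hs
  change -divergence p.2 (zeroExt s.1) x.1 - -divergence p.1 (zeroExt s.1) x.1 =
    dlog (detTransition p.1 p.2) x.1 (s.1 ⟨x.1, x.2.1⟩)
  rw [zeroExt_apply s.1 ⟨x.1, x.2.1⟩, h]
  exact neg_sub_neg _ _ |>.trans (add_sub_cancel_left _ _)

lemma comp_pairSection_chernCocycle {q : ℕ} (v : H q (tangentSheaf E M)) :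
    (v.comp (Ext.mk₀ (pairSection (cocyclePairing (contractPresheaf E M) (chartCover E M))
      (chernCocycle E M))) (add_zero q)).comp
      (cechSES_shortExact (structureSheaf E M) (chartCover E M) (chartCover_iSup E M)).extClass
        rfl = 0 := by
  rw [← negDivergence_comp_cechD]
  exact comp_mk₀_comp_extClass (S := cechSES (structureSheaf E M) (chartCover E M))
    v (negDivergence E M) _

theorem contract_firstChernClass {q : ℕ} (v : H q (tangentSheaf E M)) :
    contract (firstChernClass E M) v = 0 :=
  (cup_cechClass_pairing (contractPresheaf E M) (chartCover E M) (chartCover_iSup E M)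
    (chernCocycle E M) v).trans (comp_pairSection_chernCocycle v)

end ChernContraction

end ComplexManifold

end

theorem mainTheorem12 {E : Type} [NormedAddCommGroup E] [NormedSpace ℂ E] [FiniteDimensional ℂ E]
    {M : Type} [TopologicalSpace M] [ChartedSpace E M] [IsManifold 𝓘(ℂ, E) ω M]
    (q : ℕ) (v : ComplexManifold.H q (ComplexManifold.tangentSheaf E M)) :
    (ComplexManifold.contract (ComplexManifold.firstChernClass E M) v :
      ComplexManifold.H (q + 1) (ComplexManifold.structureSheaf E M)) = 0 :=
  ComplexManifold.contract_firstChernClass v
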